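/- Let $X$ be a Tychonoff (completely regular Hausdorff) space and let $\lambda$ be a $\pi$-network of $X$, that is, a family of nonempty subsets of $X$ such that every nonempty open subset of $X$ contains a member of $\lambda$. Let $C_\lambda(X)$ be the set of all continuous real-valued functions on $X$ with the $\lambda$-open topology, i.e. the topology with subbase consisting of the sets $[F,U]=\{f\in C(X): f(F)\subseteq U\}$, where $F\in\lambda$ and $U\subseteq\mathbb{R}$ is open. Then $C_\lambda(X)$ is Menger if and only if it is $\sigma$-compact. Here a space $Y$ is Menger if for every sequence $(\mathcal{U}_n)_{n\in\omega}$ of open covers of $Y$ there are finite subfamilies $\mathcal{V}_n\subseteq\mathcal{U}_n$ such that $\bigcup_{n\in\omega}\mathcal{V}_n$ is a cover of $Y$, and $Y$ is $\sigma$-compact if it is a union of countably many compact subspaces. -/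

import Mathlib

/-- A family `lam` of nonempty subsets of `X` is a `π`-network for `X` if every nonempty open set
contains a member of `lam`. -/
structure IsPiNetwork {X : Type*} [TopologicalSpace X] (lam : Set (Set X)) : Prop where
  nonempty : ∀ A ∈ lam, A.Nonempty
  exists_subset : ∀ U : Set X, IsOpen U → U.Nonempty → ∃ A ∈ lam, A ⊆ U

/-- The set `C(X)` of all continuous real-valued functions on `X`, as a type of its own so that it
carries the `lam`-open topology instead of the compact-open one. -/
def CLambda (X : Type*) [TopologicalSpace X] (_lam : Set (Set X)) : Type _ := C(X, ℝ)

namespace CLambda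

/-- The set `[F, U]` of all continuous `f` with `f(F) ⊆ U`. -/
def subbasic {X : Type*} [TopologicalSpace X] (lam : Set (Set X)) (F : Set X) (U : Set ℝ) :
    Set (CLambda X lam) :=
  {f : C(X, ℝ) | f '' F ⊆ U}

/-- The `lam`-open topology: the topology with subbase `[F, U]`, where `F ∈ lam` and `U` is an open
subset of `ℝ`. -/
instance instTopologicalSpace {X : Type*} [TopologicalSpace X] (lam : Set (Set X)) :
    TopologicalSpace (CLambda X lam) :=
  TopologicalSpace.generateFrom
    {S | ∃ F ∈ lam, ∃ U : Set ℝ, IsOpen U ∧ S = subbasic lam F U}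

end CLambda

/-- A space `Y` is Menger if from every sequence `𝒰 n` of open covers one can choose finite
subfamilies `𝒱 n ⊆ 𝒰 n` such that the members of all the `𝒱 n` together cover `Y`. -/
def IsMengerSpace (Y : Type*) [TopologicalSpace Y] : Prop :=
  ∀ 𝒰 : ℕ → Set (Set Y), (∀ n, (∀ U ∈ 𝒰 n, IsOpen U) ∧ ⋃₀ 𝒰 n = Set.univ) →
    ∃ 𝒱 : ℕ → Set (Set Y), (∀ n, 𝒱 n ⊆ 𝒰 n ∧ (𝒱 n).Finite) ∧ ⋃ n, ⋃₀ 𝒱 n = Set.univ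

open Set Filter Topology

/-! The Menger property gives strong structure on `X`: members of `lam` are finite sets of isolated
points, these points are dense, disjoint open sets have disjoint closures, and every continuous
function is bounded. Each fact is proved by contradiction: failure yields subbasic covers, and one
continuous function escapes all finite selections. Conversely, with `D` the isolated points, every
map from `D` to `[-n, n]` extends continuously to `X`, so `C_λ(X)` is a countable union of
continuous images of the cubes `[-n, n]^D`. -/

/-- The selection principle for covers of `C(X)` by subbasic sets `[F, U]`, encoded as pairs
`(F, U)`. -/
theorem IsMengerSpace.exists_finset_mapsTo {X : Type*} [TopologicalSpace X] {lam : Set (Set X)}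
    (h : IsMengerSpace (CLambda X lam)) (P : ℕ → Set (Set X × Set ℝ))
    (hP : ∀ n, ∀ p ∈ P n, p.1 ∈ lam ∧ IsOpen p.2)
    (hcov : ∀ n (f : C(X, ℝ)), ∃ p ∈ P n, MapsTo f p.1 p.2) :
    ∃ Q : ℕ → Set (Set X × Set ℝ), (∀ n, (Q n).Finite ∧ Q n ⊆ P n) ∧
      ∀ f : C(X, ℝ), ∃ n, ∃ p ∈ Q n, MapsTo f p.1 p.2 := by
  let S : Set X × Set ℝ → Set (CLambda X lam) := fun p => CLambda.subbasic lam p.1 p.2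
  obtain ⟨V, hV, hVc⟩ := h (fun n => S '' P n) (by
    refine fun n => ⟨?_, ?_⟩
    · rintro _ ⟨p, hp, rfl⟩
      exact TopologicalSpace.isOpen_generateFrom_of_mem
        ⟨p.1, (hP n p hp).1, p.2, (hP n p hp).2, rfl⟩
    · refine eq_univ_of_forall fun f => ?_
      obtain ⟨p, hp, hf⟩ := hcov n f
      exact ⟨S p, mem_image_of_mem _ hp, hf.image_subset⟩)
  have : ∀ n, ∃ Q ⊆ P n, Q.Finite ∧ S '' Q = V n := fun n => by
    obtain ⟨Q, hQ, hfin, himg⟩ := exists_subset_image_finite_and.1 ⟨V n, (hV n).1, (hV n).2, rfl⟩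
    exact ⟨Q, hQ, hfin, himg.symm⟩
  choose Q hQP hQf hQV using this
  refine ⟨Q, fun n => ⟨hQf n, hQP n⟩, fun f => ?_⟩
  have hf : (show CLambda X lam from f) ∈ ⋃ n, ⋃₀ V n := hVc ▸ mem_univ _
  obtain ⟨n, T, hT, hfT⟩ := mem_iUnion.1 hf
  rw [← hQV] at hT
  obtain ⟨p, hp, rfl⟩ := hT
  exact ⟨n, p, hp, mapsTo_iff_image_subset.2 hfT⟩

theorem IsMengerSpace.of_sigmaCompactSpace {Y : Type*} [TopologicalSpace Y]
    [SigmaCompactSpace Y] : IsMengerSpace Y := by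
  intro U hU
  have : ∀ n, ∃ V ⊆ U n, V.Finite ∧ compactCovering Y n ⊆ ⋃₀ V := fun n => by
    simp only [sUnion_eq_biUnion]
    refine (isCompact_compactCovering Y n).elim_finite_subcover_image (c := id) (hU n).1 ?_
    simp [← sUnion_eq_biUnion, (hU n).2]
  choose V hVU hVf hV using this
  refine ⟨V, fun n => ⟨hVU n, hVf n⟩, eq_univ_of_univ_subset ?_⟩
  rw [← iUnion_compactCovering Y]
  exact iUnion_mono hV

/-! ### Functions that escape finite selections -/

theorem exists_continuousMap_eq_one_eq_zero {X : Type*} [TopologicalSpace X]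
    [CompletelyRegularSpace X] {S C : Set X} (hS : S.Finite) (hC : IsClosed C)
    (hd : Disjoint S C) :
    ∃ f : C(X, ℝ), (∀ x ∈ S, f x = 1) ∧ (∀ x ∈ C, f x = 0) ∧ ∀ x, f x ∈ Icc (0 : ℝ) 1 := by
  induction S, hS using Set.Finite.induction_on with
  | empty => exact ⟨0, by simp, by simp, by simp⟩
  | @insert a S _ _ ih =>
    obtain ⟨f, hf1, hf0, hf⟩ := ih (hd.mono_left (subset_insert _ _))
    obtain ⟨g, hg, hg0, hg1⟩ := CompletelyRegularSpace.completely_regular a C hC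
      (disjoint_left.1 hd (mem_insert _ _))
    let g' : C(X, ℝ) := ⟨fun x => 1 - g x, by fun_prop⟩
    have hg' : ∀ x, g' x ∈ Icc (0 : ℝ) 1 := fun x =>
      ⟨sub_nonneg.2 (g x).2.2, sub_le_self _ (g x).2.1⟩
    refine ⟨f ⊔ g', ?_, fun x hx => ?_, fun x => ?_⟩
    · rintro x (rfl | hx)
      · have : g' x = 1 := by simp [g', hg0]
        simp [this, (hf x).2]
      · simp [hf1 x hx, (hg' x).2]
    · have : g' x = 0 := by simp [g', hg1 hx]
      simp [hf0 x hx, this]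
    · exact ⟨(hf x).1.trans (by simp), by simp [(hf x).2, (hg' x).2]⟩

theorem exists_continuousMap_pow_le {X : Type*} [TopologicalSpace X]
    [CompletelyRegularSpace X] {S : ℕ → Set X} {C : Set X} (hS : ∀ n, (S n).Finite)
    (hC : IsClosed C) (hd : ∀ n, Disjoint (S n) C) :
    ∃ f : C(X, ℝ), (∀ n, ∀ x ∈ S n, (1 / 2 : ℝ) ^ n ≤ f x) ∧ ∀ x ∈ C, f x = 0 := by
  choose g hg1 hg0 hg using fun n => exists_continuousMap_eq_one_eq_zero (hS n) hC (hd n)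
  have hle : ∀ n x, (1 / 2 : ℝ) ^ n * g n x ≤ (1 / 2) ^ n := fun n x =>
    mul_le_of_le_one_right (by positivity) (hg n x).2
  have hnn : ∀ n x, 0 ≤ (1 / 2 : ℝ) ^ n * g n x := fun n x =>
    mul_nonneg (by positivity) (hg n x).1
  refine ⟨⟨fun x => ∑' n, (1 / 2 : ℝ) ^ n * g n x,
    continuous_tsum (fun n => by fun_prop) summable_geometric_two fun n x => ?_⟩,
    fun n x hx => ?_, fun x hx => ?_⟩
  · rw [Real.norm_of_nonneg (hnn n x)]
    exact hle n x
  · have := (Summable.of_nonneg_of_le (fun n => hnn n x) (fun n => hle n x)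
      summable_geometric_two).le_tsum n fun m _ => hnn m x
    simpa [hg1 n x hx] using this
  · simp [hg0 _ x hx]

/-- A function with values `(1 / 2) ^ n` at isolated points `a n` and `0` elsewhere. -/
theorem exists_continuousMap_isolated {X : Type*} [TopologicalSpace X] [T1Space X] {a : ℕ → X}
    (ha : a.Injective) (ho : ∀ n, IsOpen {a n}) :
    ∃ f : C(X, ℝ), (∀ n, f (a n) = (1 / 2) ^ n) ∧ ∀ x ∉ range a, f x = 0 := by
  have hind : ∀ n, Continuous (({a n} : Set X).indicator fun _ => (1 / 2 : ℝ) ^ n) := fun n =>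
    IsClopen.continuous_indicator ⟨isClosed_singleton, ho n⟩ continuous_const
  refine ⟨⟨fun x => ∑' n, ({a n} : Set X).indicator (fun _ => (1 / 2 : ℝ) ^ n) x,
    continuous_tsum hind summable_geometric_two fun n x => ?_⟩, fun n => ?_, fun x hx => ?_⟩
  · refine (norm_indicator_le_norm_self _ _).trans ?_
    simp
  · have := tsum_eq_single (L := .unconditional ℕ)
      (f := fun m => ({a m} : Set X).indicator (fun _ => (1 / 2 : ℝ) ^ m) (a n)) n
      (fun m hm => indicator_of_notMem (by simpa using ha.ne hm.symm) _)
    simpa using this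
  · have : ∀ n, x ≠ a n := fun n h => hx ⟨n, h.symm⟩
    simp [this]

/-- The monotone step function `B` dominates the required bounds and is locally bounded, so a
partition of unity puts a continuous function above it. -/
theorem exists_continuousMap_of_bound (K : ℕ → ℝ) :
    ∃ φ : C(ℝ, ℝ), ∀ (n : ℕ) (t : ℝ), n < t → K n ≤ φ t := by
  let B : ℝ → ℝ := fun t => ∑ m ∈ Finset.range ⌈t⌉₊, |K m|
  have hB : Monotone B := fun s t h =>
    Finset.sum_le_sum_of_subset_of_nonneg
      (Finset.range_mono (Nat.ceil_mono h)) fun _ _ _ => abs_nonneg _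
  obtain ⟨φ, hφ⟩ := exists_continuous_forall_mem_convex_of_local_const
    (t := fun x => Ici (B x)) (fun x => convex_Ici _) fun x => ⟨B (x + 1), by
      filter_upwards [Iio_mem_nhds (lt_add_one x)] with y hy using hB hy.le⟩
  refine ⟨φ, fun n t hn => (le_abs_self _).trans (le_trans ?_ (hφ t))⟩
  exact Finset.single_le_sum (f := fun m => |K m|) (fun _ _ => abs_nonneg _)
    (Finset.mem_range.2 (Nat.lt_ceil.2 hn))

/-! ### Consequences of the Menger property -/

section Menger

variable {X : Type*} [TopologicalSpace X] {lam : Set (Set X)}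

theorem IsPiNetwork.singleton_mem (hlam : IsPiNetwork lam) {x : X} (hx : IsOpen {x}) :
    {x} ∈ lam := by
  obtain ⟨A, hA, hAx⟩ := hlam.exists_subset {x} hx (singleton_nonempty x)
  rwa [← (hlam.nonempty A hA).subset_singleton_iff.1 hAx]

theorem IsPiNetwork.exists_mapsTo (hlam : IsPiNetwork lam) {U : Set X} (hU : IsOpen U)
    (f : C(X, ℝ)) {V : Set ℝ} (hV : IsOpen V) {x : X} (hx : x ∈ U) (hfx : f x ∈ V) :
    ∃ A ∈ lam, A ⊆ U ∧ MapsTo f A V := by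
  obtain ⟨A, hA, hAU⟩ := hlam.exists_subset (U ∩ f ⁻¹' V) (hU.inter (hV.preimage f.continuous))
    ⟨x, hx, hfx⟩
  exact ⟨A, hA, fun y hy => (hAU hy).1, fun y hy => (hAU hy).2⟩

variable [T35Space X]

/-- Disjoint open sets have disjoint closures. -/
theorem IsMengerSpace.disjoint_closure (h : IsMengerSpace (CLambda X lam))
    (hlam : IsPiNetwork lam) {U V : Set X} (hU : IsOpen U) (hV : IsOpen V) (hd : Disjoint U V) :
    Disjoint (closure U) (closure V) := by
  rw [disjoint_left]
  intro x hxU hxV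
  obtain ⟨Q, hQ, hQc⟩ := h.exists_finset_mapsTo
    (fun n => {p | p.1 ∈ lam ∧ p.1 ⊆ U ∧ p.2 = Iio ((1 / 2) ^ n)} ∪
      {p | p.1 ∈ lam ∧ p.1 ⊆ V ∧ p.2 = {0}ᶜ}) (by
      rintro n p (⟨hp, -, hp2⟩ | ⟨hp, -, hp2⟩)
      · exact ⟨hp, hp2 ▸ isOpen_Iio⟩
      · exact ⟨hp, hp2 ▸ isOpen_compl_singleton⟩) (by
      intro n f
      -- If `f` vanishes on `V`, then `f x = 0`, so `f` is small somewhere on `U`.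
      by_cases hf : ∃ y ∈ V, f y ≠ 0
      · obtain ⟨y, hy, hfy⟩ := hf
        obtain ⟨A, hA, hAV, hfA⟩ := hlam.exists_mapsTo hV f isOpen_compl_singleton hy hfy
        exact ⟨(A, {0}ᶜ), .inr ⟨hA, hAV, rfl⟩, hfA⟩
      · push Not at hf
        have hfx : f x = 0 :=
          closure_minimal (t := f ⁻¹' {0}) hf (isClosed_singleton.preimage f.continuous) hxV
        obtain ⟨y, hyf, hyU⟩ := mem_closure_iff.1 hxU (f ⁻¹' Iio ((1 / 2) ^ n))
          (isOpen_Iio.preimage f.continuous) (by simp [hfx])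
        obtain ⟨A, hA, hAU, hfA⟩ := hlam.exists_mapsTo hU f isOpen_Iio hyU hyf
        exact ⟨(A, _), .inl ⟨hA, hAU, rfl⟩, hfA⟩)
  have : Nonempty X := ⟨x⟩
  choose! c hc using fun A (hA : A ∈ lam) => hlam.nonempty A hA
  obtain ⟨f, hf, hf0⟩ := exists_continuousMap_pow_le (C := Uᶜ)
    (S := fun n => (fun p => c p.1) '' {p ∈ Q n | p.1 ∈ lam ∧ p.1 ⊆ U})
    (fun n => ((hQ n).1.sep _).image _) hU.isClosed_compl (by
      intro n
      rw [disjoint_left]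
      rintro _ ⟨p, ⟨-, hp, hpU⟩, rfl⟩ hx
      exact hx (hpU (hc _ hp)))
  obtain ⟨n, p, hp, hfp⟩ := hQc f
  rcases (hQ n).2 hp with ⟨hpl, hpU, hp2⟩ | ⟨hpl, hpV, hp2⟩
  · have h1 := hfp (hc _ hpl)
    rw [hp2] at h1
    exact absurd (hf n _ ⟨p, ⟨hp, hpl, hpU⟩, rfl⟩) (not_le.2 h1)
  · have h1 := hfp (hc _ hpl)
    rw [hp2] at h1
    exact h1 (hf0 _ (disjoint_right.1 hd (hpV (hc _ hpl))))

/-- All points of members of the `π`-network are isolated. -/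
theorem IsMengerSpace.isOpen_singleton (h : IsMengerSpace (CLambda X lam))
    (hlam : IsPiNetwork lam) {A : Set X} (hA : A ∈ lam) {a : X} (ha : a ∈ A) :
    IsOpen {a} := by
  by_contra hiso
  obtain ⟨Q, hQ, hQc⟩ := h.exists_finset_mapsTo
    (fun n => {p | p.1 ∈ lam ∧ p.1 ⊆ {a}ᶜ ∧ p.2 = Iio ((1 / 2) ^ n)} ∪ {(A, {0}ᶜ)}) (by
      rintro n p (⟨hp, -, hp2⟩ | rfl)
      · exact ⟨hp, hp2 ▸ isOpen_Iio⟩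
      · exact ⟨hA, isOpen_compl_singleton⟩) (by
      intro n f
      by_cases hf : ∃ y ∈ A, f y = 0
      · obtain ⟨y, hy, hfy⟩ := hf
        let W := f ⁻¹' Iio ((1 / 2) ^ n)
        have hW : IsOpen W := isOpen_Iio.preimage f.continuous
        have hyW : y ∈ W := by simp [W, hfy]
        -- The zero `y` may be `a` itself; non-isolation of `a` supplies another point.
        have : ∃ z ∈ W, z ≠ a := by
          by_contra! hWa
          exact hiso ((show W = {a} from
            (Set.Nonempty.subset_singleton_iff ⟨y, hyW⟩).1 hWa) ▸ hW)
        obtain ⟨z, hzW, hza⟩ := this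
        obtain ⟨B, hB, hBU, hfB⟩ :=
          hlam.exists_mapsTo isOpen_compl_singleton f isOpen_Iio hza hzW
        exact ⟨(B, _), .inl ⟨hB, hBU, rfl⟩, hfB⟩
      · push Not at hf
        exact ⟨(A, {0}ᶜ), .inr rfl, hf⟩)
  have : Nonempty X := ⟨a⟩
  choose! c hc using fun A (hA : A ∈ lam) => hlam.nonempty A hA
  obtain ⟨f, hf, hf0⟩ := exists_continuousMap_pow_le (C := {a})
    (S := fun n => (fun p => c p.1) '' {p ∈ Q n | p.1 ∈ lam ∧ p.1 ⊆ {a}ᶜ})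
    (fun n => ((hQ n).1.sep _).image _) isClosed_singleton (by
      intro n
      rw [disjoint_left]
      rintro _ ⟨p, ⟨-, hp, hpU⟩, rfl⟩ hx
      exact hpU (hc _ hp) hx)
  obtain ⟨n, p, hp, hfp⟩ := hQc f
  rcases (hQ n).2 hp with ⟨hpl, hpU, hp2⟩ | rfl
  · have h1 := hfp (hc _ hpl)
    rw [hp2] at h1
    exact absurd (hf n _ ⟨p, ⟨hp, hpl, hpU⟩, rfl⟩) (not_le.2 h1)
  · exact hfp ha (hf0 a rfl)

/-- On an infinite `A`, a function can take every value `c m`, defeating all `[A, {c m}ᶜ]`, with `c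
n` placed at a point not tested for it at stage `n`. The interval `(c n / 2, c n * 2)` contains no
other `c m`. -/
theorem IsMengerSpace.finite_of_mem (h : IsMengerSpace (CLambda X lam))
    (hlam : IsPiNetwork lam) {A : Set X} (hA : A ∈ lam) : A.Finite := by
  by_contra hinf
  let c : ℕ → ℝ := fun n => (1 / 2) ^ n
  obtain ⟨Q, hQ, hQc⟩ := h.exists_finset_mapsTo
    (fun n => (fun d => ({d}, Ioo (c n / 2) (c n * 2))) '' A ∪ range fun m => (A, {c m}ᶜ)) (by
      rintro n p (⟨d, hd, rfl⟩ | ⟨m, rfl⟩)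
      · exact ⟨hlam.singleton_mem (h.isOpen_singleton hlam hA hd), isOpen_Ioo⟩
      · exact ⟨hA, isOpen_compl_singleton⟩) (by
      intro n f
      by_cases hf : ∃ y ∈ A, f y = c n
      · obtain ⟨y, hy, hfy⟩ := hf
        have : 0 < c n := by positivity
        refine ⟨_, .inl ⟨y, hy, rfl⟩, ?_⟩
        rintro _ rfl
        rw [hfy]
        constructor <;> linarith
      · push Not at hf
        exact ⟨_, .inr ⟨n, rfl⟩, hf⟩)
  let e := Set.Infinite.natEmbedding A hinf
  have he : Function.Injective fun k => (e k : X) := Subtype.val_injective.comp e.injective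
  have hev : ∀ n, ∀ᶠ k in atTop, ({(e k : X)}, Ioo (c n / 2) (c n * 2)) ∉ Q n := fun n => by
    have hinj : Function.Injective
        fun k => (({(e k : X)}, Ioo (c n / 2) (c n * 2)) : Set X × Set ℝ) :=
      fun k l hkl => he (singleton_injective (congrArg Prod.fst hkl))
    have := hinj.tendsto_cofinite.eventually (hQ n).1.eventually_cofinite_notMem
    rwa [Nat.cofinite_eq_atTop] at this
  obtain ⟨k, hk, hkQ⟩ := extraction_forall_of_eventually hev
  obtain ⟨f, hf, hf0⟩ := exists_continuousMap_isolated (he.comp hk.injective)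
    fun n => h.isOpen_singleton hlam hA (e (k n)).2
  obtain ⟨n, p, hp, hfp⟩ := hQc f
  rcases (hQ n).2 hp with ⟨d, hd, rfl⟩ | ⟨m, rfl⟩
  · have hfd := hfp (mem_singleton d)
    by_cases hda : d ∈ range ((fun k => (e k : X)) ∘ k)
    · obtain ⟨m, rfl⟩ := hda
      rw [hf m] at hfd
      have h1 : (1 / 2 : ℝ) ^ (n + 1) < (1 / 2) ^ m := by
        have := hfd.1
        simp only [c] at this
        rw [pow_succ]; linarith
      have h2 : (1 / 2 : ℝ) ^ (m + 1) < (1 / 2) ^ n := by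
        have := hfd.2
        simp only [c] at this
        rw [pow_succ]; linarith
      rw [pow_lt_pow_iff_right_of_lt_one₀ (by norm_num) (by norm_num)] at h1 h2
      obtain rfl : m = n := by omega
      exact hkQ m hp
    · rw [hf0 d hda] at hfd
      have : 0 < c n := by positivity
      linarith [hfd.1]
  · exact hfp (e (k m)).2 (hf m)

/-- For unbounded `f`, composing `|f|` with a fast-growing `φ` exceeds at `d n` every bound selected
at stage `n`. -/
theorem IsMengerSpace.exists_abs_le (h : IsMengerSpace (CLambda X lam))
    (hlam : IsPiNetwork lam) (f : C(X, ℝ)) : ∃ n : ℕ, ∀ x, |f x| ≤ n := by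
  by_contra! hunb
  have : ∀ n : ℕ, ∃ d : X, IsOpen {d} ∧ n < |f d| := fun n => by
    obtain ⟨x, hx⟩ := hunb n
    obtain ⟨A, hA, -, hfA⟩ := hlam.exists_mapsTo isOpen_univ |f| isOpen_Ioi (mem_univ x) hx
    obtain ⟨d, hd⟩ := hlam.nonempty A hA
    exact ⟨d, h.isOpen_singleton hlam hA hd, hfA hd⟩
  choose d hdo hd using this
  obtain ⟨Q, hQ, hQc⟩ := h.exists_finset_mapsTo
    (fun n => range fun k : ℕ => ({d n}, Iio (k : ℝ))) (by
      rintro n _ ⟨k, rfl⟩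
      exact ⟨hlam.singleton_mem (hdo n), isOpen_Iio⟩) (by
      intro n g
      obtain ⟨k, hk⟩ := exists_nat_gt (g (d n))
      exact ⟨_, ⟨k, rfl⟩, by rintro _ rfl; exact hk⟩)
  have hbd : ∀ n, ∃ K : ℕ, ∀ k : ℕ, (({d n} : Set X), Iio (k : ℝ)) ∈ Q n → k ≤ K := fun n => by
    have hinj : Function.Injective fun k : ℕ => ((({d n} : Set X), Iio (k : ℝ))) :=
      fun k l hkl => Nat.cast_injective (Iio_injective (congrArg Prod.snd hkl))
    obtain ⟨K, hK⟩ := ((hQ n).1.preimage hinj.injOn).bddAbove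
    exact ⟨K, fun k hk => hK hk⟩
  choose K hK using hbd
  obtain ⟨φ, hφ⟩ := exists_continuousMap_of_bound fun n => K n
  obtain ⟨n, p, hp, hgp⟩ := hQc (φ.comp |f|)
  obtain ⟨k, rfl⟩ := (hQ n).2 hp
  have h1 : φ |f (d n)| < k := hgp (mem_singleton _)
  have h2 : (k : ℝ) ≤ K n := Nat.cast_le.2 (hK n k hp)
  linarith [hφ n _ (hd n)]

end Menger

/-! ### Extension from the isolated points and σ-compactness -/

/-- Functions into a compact space extend from a dense set whose disjoint subsets have disjoint
closures. -/
theorem Dense.exists_tendsto_of_disjoint_closure {X Z : Type*} [TopologicalSpace X]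
    [TopologicalSpace Z] [CompactSpace Z] {D : Set X} (hD : Dense D)
    (hdisj : ∀ U ⊆ D, ∀ V ⊆ D, Disjoint U V → Disjoint (closure U) (closure V))
    (g : D → Z) (x : X) : ∃ z, Tendsto g (comap (↑) (𝓝 x)) (𝓝 z) := by
  have hne : (comap ((↑) : D → X) (𝓝 x)).NeBot := hD.isDenseInducing_val.comap_nhds_neBot x
  have hmem : ∀ s : Set D, x ∉ closure ((↑) '' s : Set X) → sᶜ ∈ comap ((↑) : D → X) (𝓝 x) :=
    fun s hs => ⟨_, isClosed_closure.isOpen_compl.mem_nhds hs,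
      fun y hy hys => hy (subset_closure (mem_image_of_mem _ hys))⟩
  let u := Ultrafilter.of (comap ((↑) : D → X) (𝓝 x))
  -- The trace filter is itself an ultrafilter: `x` cannot lie in the closures of both `s` and `sᶜ`.
  have hu : comap ((↑) : D → X) (𝓝 x) ≤ u := fun s hs => by
    by_contra hsF
    have h1 : x ∈ closure ((↑) '' sᶜ : Set X) := by
      by_contra hx
      exact hsF (compl_compl s ▸ hmem _ hx)
    have h2 : x ∉ closure ((↑) '' s : Set X) := disjoint_right.1
      (hdisj _ (Subtype.coe_image_subset _ _) _ (Subtype.coe_image_subset _ _)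
        ((disjoint_image_iff Subtype.val_injective).2 disjoint_compl_right)) h1
    exact Ultrafilter.compl_notMem_iff.2 hs (Ultrafilter.of_le _ (hmem s h2))
  obtain ⟨z, -, hz⟩ := isCompact_univ.ultrafilter_le_nhds (u.map g) (by simp)
  exact ⟨z, (map_mono hu).trans hz⟩

theorem CLambda.sigmaCompactSpace {X : Type*} [TopologicalSpace X] {lam : Set (Set X)} {D : Set X}
    (hD : Dense D) (hDo : ∀ d ∈ D, IsOpen {d})
    (hdisj : ∀ U ⊆ D, ∀ V ⊆ D, Disjoint U V → Disjoint (closure U) (closure V))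
    (hlam : ∀ A ∈ lam, A ⊆ D ∧ A.Finite) (hb : ∀ f : C(X, ℝ), ∃ n : ℕ, ∀ x, |f x| ≤ n) :
    SigmaCompactSpace (CLambda X lam) := by
  have hdisc : DiscreteTopology D := discreteTopology_iff_isOpen_singleton.2 fun d =>
    ⟨{(d : X)}, hDo d d.2, by ext; simp [Subtype.ext_iff]⟩
  let I : ℕ → Set ℝ := fun n => Icc (-n : ℝ) n
  have hext := fun n (g : D → I n) => hD.exists_tendsto_of_disjoint_closure hdisj g
  have hcont := fun n (g : D → I n) => hD.isDenseInducing_val.continuous_extend (hext n g)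
  let E : ∀ n, (D → I n) → C(X, ℝ) := fun n g =>
    ⟨fun x => ((hD.isDenseInducing_val.extend g x : I n) : ℝ), continuous_subtype_val.comp (hcont n g)⟩
  have hE : ∀ n g (d : D), E n g d = g d := fun n g d =>
    congrArg Subtype.val
      (hD.isDenseInducing_val.extend_eq (f := g) continuous_of_discreteTopology d)
  let Φ : ∀ n, (D → I n) → CLambda X lam := E
  -- As `A` is a finite subset of `D`, `[A, U]` pulls back to finitely many coordinate conditions.
  have hΦ : ∀ n, Continuous (Φ n) := fun n => continuous_generateFrom_iff.2 (by
    rintro _ ⟨A, hA, U, hU, rfl⟩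
    have : Φ n ⁻¹' CLambda.subbasic lam A U =
        ⋂ x : A, {g | (g ⟨x, (hlam A hA).1 x.2⟩ : ℝ) ∈ U} := by
      ext g
      simp only [mem_preimage, mem_iInter, mem_ofPred_eq, Subtype.forall]
      change E n g '' A ⊆ U ↔ _
      rw [image_subset_iff]
      refine forall₂_congr fun x hx => ?_
      rw [mem_preimage, ← hE n g ⟨x, (hlam A hA).1 hx⟩]
    rw [this]
    have := (hlam A hA).2.to_subtype
    exact isOpen_iInter_of_finite fun x => hU.preimage (by fun_prop))
  refine SigmaCompactSpace.of_countable (range fun n => range (Φ n)) (countable_range _) ?_ ?_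
  · rintro _ ⟨n, rfl⟩
    exact isCompact_range (hΦ n)
  · refine eq_univ_of_forall fun f => ?_
    obtain ⟨n, hn⟩ := hb f
    let f' : C(X, ℝ) := f
    refine ⟨_, ⟨n, rfl⟩, fun d => ⟨f' d, abs_le.1 (hn d)⟩, ?_⟩
    change E n _ = f'
    exact DFunLike.coe_injective (Continuous.ext_on hD (E n _).continuous f'.continuous
      fun d hd => hE n _ ⟨d, hd⟩)

theorem theorem3p8 {X : Type*} [TopologicalSpace X] [T35Space X]
    (lam : Set (Set X)) (hlam : IsPiNetwork lam) :
    IsMengerSpace (CLambda X lam) ↔ SigmaCompactSpace (CLambda X lam) := by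
  refine ⟨fun h => ?_, fun _ => .of_sigmaCompactSpace⟩
  have hopen : ∀ U ⊆ {d : X | IsOpen {d}}, IsOpen U := fun U hU => by
    rw [← biUnion_of_singleton U]
    exact isOpen_biUnion fun d hd => hU hd
  refine CLambda.sigmaCompactSpace (D := {d | IsOpen {d}})
    (dense_iff_inter_open.2 fun U hU hne => ?_)
    (fun d hd => hd)
    (fun U hU V hV => h.disjoint_closure hlam (hopen U hU) (hopen V hV))
    (fun A hA => ⟨fun a ha => h.isOpen_singleton hlam hA ha, h.finite_of_mem hlam hA⟩)
    (h.exists_abs_le hlam)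
  obtain ⟨A, hA, hAU⟩ := hlam.exists_subset U hU hne
  obtain ⟨d, hd⟩ := hlam.nonempty A hA
  exact ⟨d, hAU hd, h.isOpen_singleton hlam hA hd⟩
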